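/- Let $n,N\in\mathbb{N}$ with $n\ge 1$ and $N\ge n+1$. Let $\mathrm{Conv}_c(\mathbb{R}^n)$ be the set of proper, lower semicontinuous, convex functions $\psi:\mathbb{R}^n\to(-\infty,\infty]$ that are coercive, i.e. $\lim_{|x|\to\infty}\psi(x)=\infty$, and let $\mathrm{LC}_c(\mathbb{R}^n)=\{e^{-\psi}:\psi\in\mathrm{Conv}_c(\mathbb{R}^n)\}$. For an extended real-valued function $\psi$ let $\mathcal{L}\psi(x)=\sup_{y\in\mathbb{R}^n}(\langle x,y\rangle-\psi(y))$ be its Legendre--Fenchel transform and $\operatorname{dom}\psi=\{\psi<\infty\}$. For $\psi\in\mathrm{Conv}_c(\mathbb{R}^n)$ and $y\in\mathbb{R}^n$ let $\ell_{\psi,y}(x)=\langle x,y\rangle+c$, where $c\in[-\infty,\infty)$ is maximal with $\ell_{\psi,y}\le\psi$ pointwise ($c=-\infty$ if no real $c$ is admissible), and for $Y\subseteq\mathbb{R}^n$ let $q_{\psi,Y}(x)=\sup_{y\in Y}\ell_{\psi,y}(x)$. Let $\operatorname{pos}(Y)$ be the set of all finite linear combinations of elements of $Y$ with nonnegative coefficients.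 For $f=e^{-\psi}\in\mathrm{LC}_c(\mathbb{R}^n)$ define $$F_N(f)=\inf\Big\{\int_{\mathbb{R}^n}e^{-q_{\psi,Y}(x)}\,dx:\ Y\subseteq\operatorname{dom}(\mathcal{L}\psi),\ \operatorname{pos}(Y)=\mathbb{R}^n,\ |Y|\le N\Big\}.$$ Finally, let $f_{\rm rot}=e^{-\psi_{\rm rot}}$, where $\psi_{\rm rot}\in\mathrm{Conv}_c(\mathbb{R}^n)$ is the rotational epi-symmetrization of $\psi$: for $n\ge2$ it is the unique function in $\mathrm{Conv}_c(\mathbb{R}^n)$ with $$\mathcal{L}\psi_{\rm rot}(x)=\int_{\mathrm{SO}(n)}\mathcal{L}\psi(\vartheta^{-1}x)\,d\vartheta\qquad(x\in\mathbb{R}^n),$$ the integral being with respect to the Haar probability measure (that is, $\psi_{\rm rot}$ is the Legendre--Fenchel transform of the right-hand side); for $n=1$, $\psi_{\rm rot}(x)=\tfrac12\inf_{y\in\mathbb{R}}\big(\psi(2x-y)+\psi(-y)\big)$. Then for every $f\in\mathrm{LC}_c(\mathbb{R}^n)$, $$F_N(f)\le F_N(f_{\rm rot}).$$ -/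

import Mathlib

open MeasureTheory
open scoped ENNReal

noncomputable section

namespace OuterLin

/-- Euclidean space `ℝⁿ`. -/
abbrev E (n : ℕ) : Type := EuclideanSpace ℝ (Fin n)

/-! ### Coercive convex functions -/

/-- `Conv_c(ℝⁿ)`: the proper, lower semicontinuous, convex, coercive functions
`ψ : ℝⁿ → (-∞, ∞]`, as functions with values in the extended reals. -/
structure IsConvC {n : ℕ} (ψ : E n → EReal) : Prop where
  ne_bot : ∀ x, ψ x ≠ ⊥
  convex : ∀ (x y : E n) (a b : ℝ), 0 < a → 0 < b → a + b = 1 →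
    ψ (a • x + b • y) ≤ (a : EReal) * ψ x + (b : EReal) * ψ y
  coercive : Filter.Tendsto ψ (Bornology.cobounded (E n)) (nhds ⊤)
  proper : ∃ x, ψ x < ⊤
  lsc : LowerSemicontinuous ψ

/-- Domain of an extended real valued function. -/
def dom {n : ℕ} (φ : E n → EReal) : Set (E n) := {x | φ x < ⊤}

/-- Legendre-Fenchel transform. -/
def conj {n : ℕ} (ψ : E n → EReal) (x : E n) : EReal :=
  ⨆ y : E n, ((inner ℝ x y : ℝ) : EReal) - ψ y

/-- Infimal convolution. -/
def infConv {n : ℕ} (ψ₁ ψ₂ : E n → EReal) (x : E n) : EReal :=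
  ⨅ y : E n, ψ₁ (x - y) + ψ₂ y

/-- Epi-multiplication `(t ⊡ ψ)(x) = t ψ(x / t)`, for `t > 0`. -/
def epiMul {n : ℕ} (t : ℝ) (ψ : E n → EReal) (x : E n) : EReal :=
  (t : EReal) * ψ (t⁻¹ • x)

/-! ### Outer linearizations -/

/-- The largest `c ∈ [-∞, ∞)` such that `x ↦ ⟨x, y⟩ + c` is bounded from above by `ψ`
(it is `-∞` if no real number `c` is admissible). -/
def affineConst {n : ℕ} (ψ : E n → EReal) (y : E n) : EReal :=
  sSup {c : EReal | ∃ r : ℝ, c = (r : EReal) ∧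
    ∀ x : E n, ((inner ℝ x y + r : ℝ) : EReal) ≤ ψ x}

/-- `ℓ_{ψ,y}`: the largest affine function with gradient `y` bounded from above by `ψ`. -/
def affineMinorant {n : ℕ} (ψ : E n → EReal) (y x : E n) : EReal :=
  ((inner ℝ x y : ℝ) : EReal) + affineConst ψ y

/-- `q_{ψ,Y}`: the generalized outer linearization of `ψ` with slope set `Y`. -/
def outerLin {n : ℕ} (ψ : E n → EReal) (Y : Set (E n)) (x : E n) : EReal :=
  ⨆ y ∈ Y, affineMinorant ψ y x

/-- `pos(Y)`: the positive hull, i.e. all finite linear combinations of elements of `Y` with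
nonnegative coefficients. -/
def pos {n : ℕ} (Y : Set (E n)) : Set (E n) := (PointedCone.hull ℝ Y : Set (E n))

/-! ### The Haar probability measure on `SO(n)` -/

/-- The rotation group `SO(n)`. -/
abbrev SO (n : ℕ) := Matrix.specialOrthogonalGroup (Fin n) ℝ

instance instMeasurableSpaceSO (n : ℕ) : MeasurableSpace (SO n) := borel (SO n)

instance instBorelSpaceSO (n : ℕ) : BorelSpace (SO n) := ⟨rfl⟩

instance instIsTopologicalGroupSO (n : ℕ) : IsTopologicalGroup (SO n) where
  continuous_mul := continuous_mul
  continuous_inv :=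
    Continuous.subtype_mk (continuous_star.comp continuous_subtype_val) _

instance instCompactSpaceSO (n : ℕ) : CompactSpace (SO n) := by
  refine isCompact_iff_compactSpace.mp ?_
  have hc : IsCompact (Set.pi Set.univ fun _ : Fin n =>
      Set.pi Set.univ fun _ : Fin n => Set.Icc (-1 : ℝ) 1) :=
    isCompact_univ_pi fun _ => isCompact_univ_pi fun _ => isCompact_Icc
  have hcl : IsClosed ((SO n : Submonoid (Matrix (Fin n) (Fin n) ℝ)) :
      Set (Matrix (Fin n) (Fin n) ℝ)) := by
    have h1 : IsClosed {A : Matrix (Fin n) (Fin n) ℝ | A * star A = 1 ∧ A.det = 1} :=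
      (isClosed_eq (by fun_prop) continuous_const).inter
        (isClosed_eq (by fun_prop) continuous_const)
    convert h1 using 1
    ext A
    simp [Matrix.mem_specialUnitaryGroup_iff, Matrix.mem_unitaryGroup_iff]
  refine IsCompact.of_isClosed_subset (X := Fin n → Fin n → ℝ) hc hcl ?_
  intro A hA i _ j _
  have h := entry_norm_bound_of_unitary (Matrix.mem_specialUnitaryGroup_iff.mp hA).1 i j
  exact abs_le.mp h

/-- The Haar probability measure on `SO(n)`. -/
def haarSO (n : ℕ) : Measure (SO n) := Measure.haarMeasure ⊤

instance instIsProbabilityMeasureHaarSO (n : ℕ) : IsProbabilityMeasure (haarSO n) :=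
  ⟨Measure.haarMeasure_self⟩

/-- The action of `SO(n)` on `ℝⁿ`. -/
def rotate {n : ℕ} (ϑ : SO n) (x : E n) : E n :=
  Matrix.toEuclideanLin (ϑ : Matrix (Fin n) (Fin n) ℝ) x

/-- Integral of an extended real valued function: the integral of its positive part minus the
integral of its negative part. -/
def erealIntegral {α : Type*} [MeasurableSpace α] (μ : Measure α) (g : α → EReal) : EReal :=
  ((∫⁻ a, (g a).toENNReal ∂μ : ℝ≥0∞) : EReal) - ((∫⁻ a, (-g a).toENNReal ∂μ : ℝ≥0∞) : EReal)

/-! ### Rotational symmetrization -/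

/-- The average `x ↦ ∫_{SO(n)} Lψ(ϑ⁻¹ x) dϑ` over the rotations of the conjugate `Lψ`. -/
def rotConj {n : ℕ} (ψ : E n → EReal) (x : E n) : EReal :=
  erealIntegral (haarSO n) fun ϑ => conj ψ (rotate ϑ⁻¹ x)

/-- The rotational epi-symmetrization `ψ_rot`. For `n = 1` it is `(1/2) ⊡ (ψ □ ψ⁻)` with
`ψ⁻(x) = ψ(-x)`. For `n ≥ 2` it is the function in `Conv_c(ℝⁿ)` whose conjugate is `rotConj ψ`;
as `rotConj ψ` is proper, lower semicontinuous and convex, this is the conjugate of `rotConj ψ`. -/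
def rotEpiSymm {n : ℕ} (ψ : E n → EReal) : E n → EReal :=
  if n = 1 then epiMul (1 / 2) (infConv ψ fun x => ψ (-x)) else conj (rotConj ψ)

/-! ### Log-concave functions -/

/-- `e^{-ψ}`, with `e^{-∞} = 0`. -/
def expNeg {n : ℕ} (ψ : E n → EReal) (x : E n) : ℝ≥0∞ := EReal.exp (-ψ x)

/-- The base function `ψ = -log f` of `f = e^{-ψ}`. -/
def baseFun {n : ℕ} (f : E n → ℝ≥0∞) (x : E n) : EReal := -ENNReal.log (f x)

/-- `LC_c(ℝⁿ) = {e^{-ψ} : ψ ∈ Conv_c(ℝⁿ)}`. Its elements only take finite values, as `ψ > -∞`. -/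
def LCc (n : ℕ) : Set (E n → ℝ≥0∞) := {f | ∃ ψ : E n → EReal, IsConvC ψ ∧ f = expNeg ψ}

/-- The rotational hypo-symmetrization `f_rot = e^{-ψ_rot}` of `f = e^{-ψ}`. -/
def hypoSymm {n : ℕ} (f : E n → ℝ≥0∞) : E n → ℝ≥0∞ := expNeg (rotEpiSymm (baseFun f))

/-- The total mass `J`. -/
def totalMass {n : ℕ} (f : E n → ℝ≥0∞) : ℝ≥0∞ := ∫⁻ x, f x

/-- The outer log-linearizations `e^{-q_{ψ,Y}}` of `f = e^{-ψ}` with `Y ⊆ dom (Lψ)`,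
`pos(Y) = ℝⁿ` and `|Y| ≤ N`. -/
def outerLogLins {n : ℕ} (N : ℕ) (f : E n → ℝ≥0∞) : Set (E n → ℝ≥0∞) :=
  {p | ∃ Y : Set (E n), Y ⊆ dom (conj (baseFun f)) ∧ pos Y = Set.univ ∧ Y.encard ≤ N ∧
    p = expNeg (outerLin (baseFun f) Y)}

/-- `F_N(f)`: the infimum of the total mass over the outer log-linearizations of `f` with at most
`N` slopes. -/
def minMass {n : ℕ} (N : ℕ) (f : E n → ℝ≥0∞) : ℝ≥0∞ := ⨅ p ∈ outerLogLins N f, totalMass p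

end OuterLin

end

noncomputable section

namespace OuterLin

/-! ### The Prékopa–Leindler inequality -/

/-! For a finite slope set Y, the mass of the outer log-linearization depends only on Y and on the
numbers t y = Lψ(y): it is `slopeMass`, the integral of min_y exp(t y - ⟨x, y⟩). The exponents are
jointly affine in x and t, so Prékopa–Leindler makes `slopeMass` log-concave in t. Its superlevel
sets are therefore convex; they are also closed, and `slopeMass` is monotone in t and unchanged when
one isometry acts on all slopes.

Let Y be admissible for ψ_rot. For almost every rotation ϑ the set ϑ⁻¹Y is admissible for ψ, so the
vector (Lψ(ϑ⁻¹y))_y lies in the superlevel set of `slopeMass` at height F_N(f)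
(`minMass_le_slopeMass`). A closed convex set contains the mean of a random vector with values in it
(`le_slopeMass_integral`), so the rotational average lies there too. This average is at most
Lψ_rot(y) at each y in Y, and monotonicity finishes the proof. For n = 1 the average runs over the
identity and the reflection.

The comparison with Lψ_rot uses the nontrivial half of Fenchel–Moreau (`le_conj_conj`), hence needs
the averaged conjugate to be convex, closed and nowhere -∞. In dimension one it comes directly from
the infimal convolution. -/

open Set Pointwise in
/-- The Brunn–Minkowski inequality for compact subsets of the line. -/
theorem volume_add_le_of_isCompact {K L C : Set ℝ} (hK : IsCompact K) (hL : IsCompact L)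
    (hK0 : K.Nonempty) (hL0 : L.Nonempty) (h : ∀ x ∈ K, ∀ y ∈ L, x + y ∈ C) :
    volume K + volume L ≤ volume C := by
  obtain ⟨m, hm⟩ := hK.exists_isGreatest hK0
  obtain ⟨l, hl⟩ := hL.exists_isLeast hL0
  -- With m = max K and l = min L, the translates K + l and m + L both lie in the sumset and meet at
  -- most in m + l.
  have h1 : volume (K + {l}) = volume K := by
    rw [add_singleton, image_add_right, measure_preimage_add_right]
  have h2 : volume ({m} + L) = volume L := by
    rw [singleton_add, image_add_left, measure_preimage_add]
  have hd : AEDisjoint volume (K + {l}) ({m} + L) := by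
    refine measure_mono_null (t := {m + l}) ?_ (by simp)
    rintro z ⟨⟨x, hx, _, rfl, rfl⟩, _, rfl, y, hy, hxy⟩
    simp only at hxy ⊢
    have := hm.2 hx
    have := hl.2 hy
    simp only [mem_singleton_iff]
    linarith
  rw [← h1, ← h2, ← measure_union₀
    (((isCompact_singleton).add hL).measurableSet.nullMeasurableSet) hd]
  refine measure_mono (union_subset ?_ ?_)
  · rintro _ ⟨x, hx, _, rfl, rfl⟩
    exact h x hx _ hl.1
  · rintro _ ⟨_, rfl, y, hy, rfl⟩
    exact h _ hm.1 y hy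

/-- The Brunn–Minkowski inequality for measurable subsets of the line. -/
theorem volume_add_le {A B C : Set ℝ} (hA : MeasurableSet A) (hB : MeasurableSet B)
    (hA0 : A.Nonempty) (hB0 : B.Nonempty) (h : ∀ x ∈ A, ∀ y ∈ B, x + y ∈ C) :
    volume A + volume B ≤ volume C := by
  obtain ⟨a, ha⟩ := hA0
  obtain ⟨b, hb⟩ := hB0
  rw [hA.measure_eq_iSup_isCompact, hB.measure_eq_iSup_isCompact]
  simp only [iSup_and']
  refine ENNReal.biSup_add_biSup_le' ⟨∅, by simp⟩ ⟨∅, by simp⟩ ?_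
  rintro K ⟨hKA, hK⟩ L ⟨hLB, hL⟩
  -- The approximating compact sets may be empty; inserting a and b restores nonemptiness.
  refine le_trans (add_le_add (measure_mono (Set.subset_insert a K))
    (measure_mono (Set.subset_insert b L)))
    (volume_add_le_of_isCompact (hK.insert a) (hL.insert b) (by simp) (by simp) ?_)
  intro x hx y hy
  exact h x (Set.insert_subset ha hKA hx) y (Set.insert_subset hb hLB hy)

/-- Layer cake formula; levels t ≥ 1 contribute nothing. -/
theorem lintegral_eq_setLIntegral_Ioo_of_le_one {f : ℝ → ℝ≥0∞} (hf : Measurable f)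
    (hf1 : ∀ x, f x ≤ 1) :
    ∫⁻ x, f x = ∫⁻ t in Set.Ioo (0 : ℝ) 1, volume {x | ENNReal.ofReal t < f x} := by
  have hft : ∀ x, f x ≠ ∞ := fun x => ne_top_of_le_ne_top ENNReal.one_ne_top (hf1 x)
  have h1 : ∫⁻ x, f x = ∫⁻ x, ENNReal.ofReal (f x).toReal :=
    lintegral_congr fun x => (ENNReal.ofReal_toReal (hft x)).symm
  rw [h1, lintegral_eq_lintegral_meas_lt volume (Filter.Eventually.of_forall fun x => by simp)
    hf.ennreal_toReal.aemeasurable, ← lintegral_indicator measurableSet_Ioi,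
    ← lintegral_indicator measurableSet_Ioo]
  refine lintegral_congr fun t => ?_
  by_cases h0 : 0 < t
  · have hs : {x | t < (f x).toReal} = {x | ENNReal.ofReal t < f x} := by
      ext x
      exact (ENNReal.ofReal_lt_iff_lt_toReal h0.le (hft x)).symm
    by_cases ht : t < 1
    · simp [Set.indicator, h0, ht, hs]
    · have : {x | t < (f x).toReal} = ∅ := by
        ext x
        have := ENNReal.toReal_mono ENNReal.one_ne_top (hf1 x)
        simp only [ENNReal.toReal_one] at this
        simp only [Set.mem_ofPred_eq, Set.mem_empty_iff_false, iff_false, not_lt]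
        linarith
      simp [Set.indicator, h0, ht, this]
  · simp [Set.indicator, h0]

/-- Weighted AM–GM, as Young's inequality with exponents 1/a and 1/b. -/
theorem rpow_mul_rpow_le_add {a b : ℝ} (ha : 0 < a) (hb : 0 < b) (hab : a + b = 1)
    (x y : ℝ≥0∞) : x ^ a * y ^ b ≤ ENNReal.ofReal a * x + ENNReal.ofReal b * y := by
  have hpq : (1 / a).HolderConjugate (1 / b) := by
    rw [Real.holderConjugate_iff]
    refine ⟨?_, by simpa using hab⟩
    rw [lt_div_iff₀ ha]; linarith
  have h := ENNReal.young_inequality (x ^ a) (y ^ b) hpq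
  rw [← ENNReal.rpow_mul, ← ENNReal.rpow_mul, mul_one_div_cancel ha.ne', mul_one_div_cancel hb.ne',
    ENNReal.rpow_one, ENNReal.rpow_one, one_div, one_div, ENNReal.ofReal_inv_of_pos ha,
    ENNReal.ofReal_inv_of_pos hb, div_eq_mul_inv, div_eq_mul_inv, inv_inv, inv_inv] at h
  rwa [mul_comm x, mul_comm y] at h

theorem lt_rpow_mul_rpow {a b : ℝ} (ha : 0 < a) (hb : 0 < b) (hab : a + b = 1)
    {t x y : ℝ≥0∞} (hx : t < x) (hy : t < y) : t < x ^ a * y ^ b := by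
  calc t = t ^ a * t ^ b := by
        rw [← ENNReal.rpow_add_of_nonneg _ _ ha.le hb.le, hab, ENNReal.rpow_one]
    _ < x ^ a * y ^ b := ENNReal.mul_lt_mul (ENNReal.rpow_lt_rpow hx ha)
        (ENNReal.rpow_lt_rpow hy hb)

open Set Pointwise in
/-- The Prékopa–Leindler inequality on the line, for functions with supremum `1`. -/
theorem prekopa_leindler_real_of_iSup_eq_one {a b : ℝ} (ha : 0 < a) (hb : 0 < b) (hab : a + b = 1)
    {f g h : ℝ → ℝ≥0∞} (hf : Measurable f) (hg : Measurable g) (hh : Measurable h)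
    (hf1 : ⨆ x, f x = 1) (hg1 : ⨆ x, g x = 1)
    (H : ∀ x y, f x ^ a * g y ^ b ≤ h (a * x + b * y)) :
    (∫⁻ x, f x) ^ a * (∫⁻ x, g x) ^ b ≤ ∫⁻ x, h x := by
  refine (rpow_mul_rpow_le_add ha hb hab _ _).trans ?_
  have hm : ∫⁻ x, min (h x) 1 ≤ ∫⁻ x, h x := lintegral_mono fun x => min_le_left _ _
  refine le_trans ?_ hm
  rw [lintegral_eq_setLIntegral_Ioo_of_le_one hf fun x => hf1 ▸ le_iSup f x,
    lintegral_eq_setLIntegral_Ioo_of_le_one hg fun x => hg1 ▸ le_iSup g x,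
    lintegral_eq_setLIntegral_Ioo_of_le_one (hh.min measurable_const) fun x => min_le_right _ _]
  have hanti : Antitone fun t : ℝ => volume {x | ENNReal.ofReal t < f x} := fun s t hst =>
    measure_mono fun x hx => (ENNReal.ofReal_le_ofReal hst).trans_lt hx
  rw [← lintegral_const_mul' _ _ ENNReal.ofReal_ne_top,
    ← lintegral_const_mul' _ _ ENNReal.ofReal_ne_top,
    ← lintegral_add_left (hanti.measurable.const_mul _)]
  refine setLIntegral_mono' measurableSet_Ioo fun t ht => ?_
  have ht1 : ENNReal.ofReal t < 1 := by simpa using ht.2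
  have hmeas : ∀ k : ℝ → ℝ≥0∞, Measurable k → MeasurableSet {x | ENNReal.ofReal t < k x} :=
    fun k hk => measurableSet_lt measurable_const hk
  -- Both suprema equal 1, so at every level t < 1 both superlevel sets are nonempty, as
  -- Brunn–Minkowski requires.
  obtain ⟨x₀, hx₀⟩ := lt_iSup_iff.1 (hf1 ▸ ht1)
  obtain ⟨y₀, hy₀⟩ := lt_iSup_iff.1 (hg1 ▸ ht1)
  have hv : ∀ (c : ℝ) (hc : 0 < c) (S : Set ℝ),
      ENNReal.ofReal c * volume S = volume (c • S) := fun c hc S => by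
    rw [Measure.addHaar_smul]; simp [abs_of_pos hc]
  rw [hv a ha, hv b hb]
  refine volume_add_le ((hmeas f hf).const_smul₀ a) ((hmeas g hg).const_smul₀ b)
    ⟨a • x₀, smul_mem_smul_set hx₀⟩ ⟨b • y₀, smul_mem_smul_set hy₀⟩ ?_
  rintro _ ⟨x, hx, rfl⟩ _ ⟨y, hy, rfl⟩
  exact lt_min ((lt_rpow_mul_rpow ha hb hab hx hy).trans_le (H x y)) ht1

/-- The Prékopa–Leindler inequality on the line, for bounded functions. -/
theorem prekopa_leindler_real_of_bounded {a b : ℝ} (ha : 0 < a) (hb : 0 < b) (hab : a + b = 1)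
    {f g h : ℝ → ℝ≥0∞} (hf : Measurable f) (hg : Measurable g) (hh : Measurable h)
    (hf1 : ⨆ x, f x ≠ ∞) (hg1 : ⨆ x, g x ≠ ∞)
    (H : ∀ x y, f x ^ a * g y ^ b ≤ h (a * x + b * y)) :
    (∫⁻ x, f x) ^ a * (∫⁻ x, g x) ^ b ≤ ∫⁻ x, h x := by
  by_cases hf0 : ⨆ x, f x = 0
  · have : ∀ x, f x = 0 := by simpa using hf0
    simp [this, ENNReal.zero_rpow_of_pos ha]
  by_cases hg0 : ⨆ x, g x = 0
  · have : ∀ x, g x = 0 := by simpa using hg0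
    simp [this, ENNReal.zero_rpow_of_pos hb]
  set α := ⨆ x, f x
  set β := ⨆ x, g x
  have hαa0 : α ^ a ≠ 0 := by simp [ENNReal.rpow_eq_zero_iff, hf0, hf1]
  have hβb0 : β ^ b ≠ 0 := by simp [ENNReal.rpow_eq_zero_iff, hg0, hg1]
  have hαa : α ^ a ≠ ∞ := ENNReal.rpow_ne_top_of_nonneg ha.le hf1
  have hβb : β ^ b ≠ ∞ := ENNReal.rpow_ne_top_of_nonneg hb.le hg1
  have key : ∀ x y : ℝ≥0∞, (α⁻¹ * x) ^ a * (β⁻¹ * y) ^ b = (α ^ a * β ^ b)⁻¹ * (x ^ a * y ^ b) := by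
    intro x y
    rw [ENNReal.mul_rpow_of_nonneg _ _ ha.le, ENNReal.mul_rpow_of_nonneg _ _ hb.le,
      ENNReal.inv_rpow, ENNReal.inv_rpow, ENNReal.mul_inv (Or.inl hαa0) (Or.inl hαa)]
    ring
  have hc0 : (α ^ a * β ^ b)⁻¹ ≠ 0 := ENNReal.inv_ne_zero.2 (ENNReal.mul_ne_top hαa hβb)
  have hct : (α ^ a * β ^ b)⁻¹ ≠ ∞ := ENNReal.inv_ne_top.2 (mul_ne_zero hαa0 hβb0)
  have h1 := prekopa_leindler_real_of_iSup_eq_one ha hb hab (hf.const_mul α⁻¹) (hg.const_mul β⁻¹)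
    (hh.const_mul (α ^ a * β ^ b)⁻¹)
    (by rw [← ENNReal.mul_iSup]; exact ENNReal.inv_mul_cancel hf0 hf1)
    (by rw [← ENNReal.mul_iSup]; exact ENNReal.inv_mul_cancel hg0 hg1)
    (fun x y => by rw [key]; gcongr; exact H x y)
  rw [lintegral_const_mul _ hf, lintegral_const_mul _ hg, lintegral_const_mul _ hh, key] at h1
  exact (ENNReal.mul_le_mul_iff_right hc0 hct).1 h1

/-- Monotone convergence; the power p, an order isomorphism, commutes with the supremum. -/
theorem lintegral_rpow_mul_le_of_truncation {f : ℝ → ℝ≥0∞} (hf : Measurable f) {p : ℝ}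
    (hp : 0 < p) {c I : ℝ≥0∞} (h : ∀ k : ℕ, (∫⁻ x, min (f x) k) ^ p * c ≤ I) :
    (∫⁻ x, f x) ^ p * c ≤ I := by
  have h1 : ∀ x, f x = ⨆ k : ℕ, min (f x) k := fun x => by
    rw [← inf_iSup_eq (f x) (fun k : ℕ => (k : ℝ≥0∞)), ENNReal.iSup_natCast]; simp
  have h2 : ∫⁻ x, f x = ⨆ k : ℕ, ∫⁻ x, min (f x) k := by
    rw [lintegral_congr h1, lintegral_iSup (fun k => hf.min measurable_const)]
    intro k l hkl x
    exact min_le_min le_rfl (by exact_mod_cast hkl)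
  have h3 := (ENNReal.orderIsoRpow p hp).map_iSup fun k : ℕ => ∫⁻ x, min (f x) k
  simp only [ENNReal.orderIsoRpow_apply] at h3
  rw [h2, h3, ENNReal.iSup_mul]
  exact iSup_le h

/-- The Prékopa–Leindler inequality on the line. -/
theorem prekopa_leindler_real {a b : ℝ} (ha : 0 < a) (hb : 0 < b) (hab : a + b = 1)
    {f g h : ℝ → ℝ≥0∞} (hf : Measurable f) (hg : Measurable g) (hh : Measurable h)
    (H : ∀ x y, f x ^ a * g y ^ b ≤ h (a * x + b * y)) :
    (∫⁻ x, f x) ^ a * (∫⁻ x, g x) ^ b ≤ ∫⁻ x, h x := by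
  have hbd : ∀ (k : ℕ) (u : ℝ → ℝ≥0∞), ⨆ x, min (u x) k ≠ ∞ := fun k u =>
    ne_top_of_le_ne_top (ENNReal.natCast_ne_top k) (iSup_le fun x => min_le_right _ _)
  refine lintegral_rpow_mul_le_of_truncation hf ha fun k => ?_
  rw [mul_comm]
  refine lintegral_rpow_mul_le_of_truncation hg hb fun l => ?_
  rw [mul_comm]
  refine prekopa_leindler_real_of_bounded ha hb hab (hf.min measurable_const)
    (hg.min measurable_const) hh (hbd k f) (hbd l g) fun x y => le_trans ?_ (H x y)
  gcongr <;> exact min_le_left _ _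

theorem measurable_fin_cons {n : ℕ} :
    Measurable fun p : ℝ × (Fin n → ℝ) => (Fin.cons p.1 p.2 : Fin (n + 1) → ℝ) := by
  refine measurable_pi_iff.2 fun i => Fin.cases ?_ (fun j => ?_) i
  · exact measurable_fst
  · exact (measurable_pi_apply j).comp measurable_snd

theorem lintegral_fin_succ {n : ℕ} {f : (Fin (n + 1) → ℝ) → ℝ≥0∞} (hf : Measurable f) :
    ∫⁻ x, f x = ∫⁻ s : ℝ, ∫⁻ v : Fin n → ℝ, f (Fin.cons s v) := by
  have he := (volume_preserving_piFinSuccAbove (fun _ : Fin (n + 1) => ℝ) 0).symm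
  have hc : ∀ p : ℝ × (Fin n → ℝ),
      (MeasurableEquiv.piFinSuccAbove (fun _ : Fin (n + 1) => ℝ) 0).symm p = Fin.cons p.1 p.2 :=
    fun p => Fin.insertNth_zero' p.1 p.2
  rw [← he.lintegral_comp hf, Measure.volume_eq_prod]
  simp only [hc]
  exact lintegral_prod _ (hf.comp measurable_fin_cons).aemeasurable

/-- The Prékopa–Leindler inequality. -/
theorem prekopa_leindler {a b : ℝ} (ha : 0 < a) (hb : 0 < b) (hab : a + b = 1) {n : ℕ}
    {f g h : (Fin n → ℝ) → ℝ≥0∞} (hf : Measurable f) (hg : Measurable g) (hh : Measurable h)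
    (H : ∀ x y, f x ^ a * g y ^ b ≤ h (a • x + b • y)) :
    (∫⁻ x, f x) ^ a * (∫⁻ x, g x) ^ b ≤ ∫⁻ x, h x := by
  induction n with
  | zero =>
    have hv := Measure.volume_pi_eq_dirac (0 : Fin 0 → ℝ)
    simp only [hv, lintegral_dirac]
    simpa using H 0 0
  | succ n ih =>
    rw [lintegral_fin_succ hf, lintegral_fin_succ hg, lintegral_fin_succ hh]
    have hslice : ∀ (u : (Fin (n + 1) → ℝ) → ℝ≥0∞) (hu : Measurable u),
        Measurable fun s : ℝ => ∫⁻ v : Fin n → ℝ, u (Fin.cons s v) := fun u hu =>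
      (hu.comp measurable_fin_cons).lintegral_prod_right'
    have hsec : ∀ (u : (Fin (n + 1) → ℝ) → ℝ≥0∞) (hu : Measurable u) (s : ℝ),
        Measurable fun v : Fin n → ℝ => u (Fin.cons s v) := fun u hu s =>
      (hu.comp measurable_fin_cons).comp measurable_prodMk_left
    -- By the induction hypothesis, the slice integrals satisfy the hypothesis of the
    -- one-dimensional inequality.
    refine prekopa_leindler_real ha hb hab (hslice f hf) (hslice g hg) (hslice h hh)
      fun s t => ih (hsec f hf s) (hsec g hg t) (hsec h hh _) fun v w => ?_
    convert H (Fin.cons s v) (Fin.cons t w) using 2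
    ext i
    refine Fin.cases ?_ (fun j => ?_) i <;> simp

/-- The Prékopa–Leindler inequality in Euclidean space. -/
theorem prekopa_leindler_euclidean {a b : ℝ} (ha : 0 < a) (hb : 0 < b) (hab : a + b = 1) {n : ℕ}
    {f g h : E n → ℝ≥0∞} (hf : Measurable f) (hg : Measurable g) (hh : Measurable h)
    (H : ∀ x y, f x ^ a * g y ^ b ≤ h (a • x + b • y)) :
    (∫⁻ x, f x) ^ a * (∫⁻ x, g x) ^ b ≤ ∫⁻ x, h x := by
  have hmp := PiLp.volume_preserving_toLp (Fin n)
  rw [← hmp.lintegral_comp hf, ← hmp.lintegral_comp hg, ← hmp.lintegral_comp hh]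
  exact prekopa_leindler ha hb hab (hf.comp hmp.measurable) (hg.comp hmp.measurable)
    (hh.comp hmp.measurable) fun x y => H _ _

/-! ### Total mass of log-linear functions with given slopes -/

/-- The total mass of `x ↦ min_i exp (t i - ⟨x, v i⟩)`. -/
def slopeMass {n : ℕ} {ι : Type*} (v : ι → E n) (t : ι → ℝ) : ℝ≥0∞ :=
  ∫⁻ x : E n, ⨅ i, ENNReal.ofReal (Real.exp (t i - inner ℝ x (v i)))

theorem measurable_iInf_exp {n : ℕ} {ι : Type*} [Countable ι] (v : ι → E n) (t : ι → ℝ) :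
    Measurable fun x : E n => ⨅ i, ENNReal.ofReal (Real.exp (t i - inner ℝ x (v i))) := by
  refine Measurable.iInf fun i => Continuous.measurable ?_
  exact ENNReal.continuous_ofReal.comp (by fun_prop)

theorem slopeMass_logConcave {n : ℕ} {ι : Type*} [Countable ι] (v : ι → E n) (s t : ι → ℝ)
    {a b : ℝ} (ha : 0 < a) (hb : 0 < b) (hab : a + b = 1) :
    slopeMass v s ^ a * slopeMass v t ^ b ≤ slopeMass v (a • s + b • t) := by
  refine prekopa_leindler_euclidean ha hb hab (measurable_iInf_exp v s) (measurable_iInf_exp v t)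
    (measurable_iInf_exp v _) fun x y => le_iInf fun i => ?_
  calc _ ≤ ENNReal.ofReal (Real.exp (s i - inner ℝ x (v i))) ^ a *
        ENNReal.ofReal (Real.exp (t i - inner ℝ y (v i))) ^ b := by
        gcongr <;> exact iInf_le _ i
    _ = _ := by
        rw [ENNReal.ofReal_rpow_of_pos (Real.exp_pos _), ENNReal.ofReal_rpow_of_pos (Real.exp_pos _),
          ← Real.exp_mul, ← Real.exp_mul, ← ENNReal.ofReal_mul (Real.exp_pos _).le, ← Real.exp_add]
        congr 2
        simp only [Pi.add_apply, Pi.smul_apply, smul_eq_mul, inner_add_left, real_inner_smul_left]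
        ring

/-- With ε = 0 this is monotonicity; letting ε → 0 gives closedness of superlevel sets. -/
theorem slopeMass_le_exp_mul {n : ℕ} {ι : Type*} [Countable ι] (v : ι → E n) {s t : ι → ℝ} {ε : ℝ}
    (h : ∀ i, s i ≤ t i + ε) :
    slopeMass v s ≤ ENNReal.ofReal (Real.exp ε) * slopeMass v t := by
  rw [slopeMass, slopeMass, ← lintegral_const_mul _ (measurable_iInf_exp v t)]
  refine lintegral_mono fun x => ?_
  rw [ENNReal.mul_iInf_of_ne (by simp [Real.exp_pos]) ENNReal.ofReal_ne_top]
  refine iInf_mono fun i => ?_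
  rw [← ENNReal.ofReal_mul (Real.exp_pos _).le, ← Real.exp_add]
  gcongr
  linarith [h i]

theorem convex_setOf_le_slopeMass {n : ℕ} {ι : Type*} [Countable ι] (v : ι → E n) (m : ℝ≥0∞) :
    Convex ℝ {t : ι → ℝ | m ≤ slopeMass v t} := by
  refine convex_iff_forall_pos.2 fun s hs t ht a b ha hb hab => ?_
  calc m = m ^ a * m ^ b := by
        rw [← ENNReal.rpow_add_of_nonneg _ _ ha.le hb.le, hab, ENNReal.rpow_one]
    _ ≤ slopeMass v s ^ a * slopeMass v t ^ b := by gcongr <;> assumption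
    _ ≤ _ := slopeMass_logConcave v s t ha hb hab

theorem isClosed_setOf_le_slopeMass {n : ℕ} {ι : Type*} [Fintype ι] (v : ι → E n) (m : ℝ≥0∞) :
    IsClosed {t : ι → ℝ | m ≤ slopeMass v t} := by
  refine isClosed_of_closure_subset fun t ht => ?_
  have key : ∀ ε : ℝ, 0 < ε → m ≤ ENNReal.ofReal (Real.exp ε) * slopeMass v t := by
    intro ε hε
    obtain ⟨s, hs, hst⟩ := Metric.mem_closure_iff.1 ht ε hε
    refine le_trans hs (slopeMass_le_exp_mul v fun i => ?_)
    have h := (dist_le_pi_dist t s i).trans hst.le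
    rw [Real.dist_eq, abs_le] at h
    linarith [h.1]
  by_cases htop : slopeMass v t = ∞
  · simp [htop]
  have hlim : Filter.Tendsto (fun ε : ℝ => ENNReal.ofReal (Real.exp ε) * slopeMass v t)
      (nhdsWithin 0 (Set.Ioi 0)) (nhds (1 * slopeMass v t)) := by
    refine ENNReal.Tendsto.mul_const ?_ (Or.inr htop)
    have h0 : Continuous fun ε : ℝ => ENNReal.ofReal (Real.exp ε) :=
      ENNReal.continuous_ofReal.comp (by fun_prop)
    simpa using (h0.tendsto 0).mono_left nhdsWithin_le_nhds
  rw [one_mul] at hlim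
  exact ge_of_tendsto hlim (Filter.eventually_of_mem self_mem_nhdsWithin key)

theorem slopeMass_comp_isometry {n : ℕ} {ι : Type*} [Countable ι] (v : ι → E n) (t : ι → ℝ)
    (U : E n ≃ₗᵢ[ℝ] E n) : slopeMass (fun i => U (v i)) t = slopeMass v t := by
  rw [slopeMass, ← U.measurePreserving.lintegral_comp (measurable_iInf_exp _ _)]
  simp only [LinearIsometryEquiv.inner_map_map]
  rfl

/-! ### The conjugate and outer linearizations -/

theorem conj_le_coe_iff {n : ℕ} {ψ : E n → EReal} {y : E n} {r : ℝ} :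
    conj ψ y ≤ r ↔ ∀ x, ((inner ℝ x y - r : ℝ) : EReal) ≤ ψ x := by
  refine iSup_le_iff.trans (forall_congr' fun x => ?_)
  rw [real_inner_comm, EReal.coe_sub]
  induction ψ x with
  | bot => simp [← EReal.coe_sub]
  | top => simp
  | coe z =>
    norm_cast
    constructor <;> intro h <;> linarith

theorem affineConst_eq_neg_conj {n : ℕ} (ψ : E n → EReal) (y : E n) :
    affineConst ψ y = -conj ψ y := by
  have h : ∀ r : ℝ, (∀ x : E n, ((inner ℝ x y + r : ℝ) : EReal) ≤ ψ x) ↔ (r : EReal) ≤ -conj ψ y := by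
    intro r
    rw [EReal.le_neg, ← EReal.coe_neg, conj_le_coe_iff]
    simp
  refine le_antisymm (sSup_le ?_) ?_
  · rintro _ ⟨r, rfl, hr⟩
    exact (h r).1 hr
  · refine EReal.ge_of_forall_gt_iff_ge.1 fun r hr => le_sSup ⟨r, rfl, (h r).2 hr.le⟩

/-- The constant of the affine minorant is -Lψ(y), and the decreasing map e^{-·} turns the supremum
over slopes into an infimum. -/
theorem totalMass_outerLin {n : ℕ} {ψ : E n → EReal} {Y : Set (E n)} {t : Y → ℝ}
    (ht : ∀ y : Y, conj ψ y = t y) :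
    totalMass (expNeg (outerLin ψ Y)) = slopeMass (fun y : Y => (y : E n)) t := by
  refine lintegral_congr fun x => ?_
  have h1 : -outerLin ψ Y x = ⨅ y : Y, ((t y - inner ℝ x y : ℝ) : EReal) := by
    rw [outerLin, ← iSup_subtype'']
    rw [show ∀ z : EReal, -z = EReal.negOrderIso z from fun _ => rfl, OrderIso.map_iSup]
    refine iInf_congr fun y => ?_
    simp only [affineMinorant, affineConst_eq_neg_conj, ht]
    change -(((inner ℝ x (y : E n) : ℝ) : EReal) + -((t y : ℝ) : EReal)) = _
    norm_cast
    ring_nf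
  rw [expNeg, h1, ← EReal.expOrderIso_apply, OrderIso.map_iInf]
  simp only [EReal.expOrderIso_apply, EReal.exp_coe]

theorem baseFun_expNeg {n : ℕ} (ψ : E n → EReal) : baseFun (expNeg ψ) = ψ := by
  funext x
  simp [baseFun, expNeg]

theorem conj_ne_bot {n : ℕ} {ψ : E n → EReal} {x₀ : E n} (h : ψ x₀ < ⊤) (y : E n) :
    conj ψ y ≠ ⊥ := by
  intro hy
  have h1 : ((inner ℝ y x₀ : ℝ) : EReal) - ψ x₀ ≤ conj ψ y :=
    le_iSup (fun x => ((inner ℝ y x : ℝ) : EReal) - ψ x) x₀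
  rw [hy, le_bot_iff, sub_eq_add_neg, EReal.add_eq_bot_iff] at h1
  simp [h.ne] at h1

/-- The mass of an outer log-linearization bounds `F_N` from above, in terms of the slopes and
the values of the conjugate. -/
theorem minMass_le_slopeMass {n N : ℕ} {ψ : E n → EReal} {x₀ : E n} (hx₀ : ψ x₀ < ⊤)
    {Y : Set (E n)} (hpos : pos Y = Set.univ) (hN : Y.encard ≤ N) [Countable Y]
    (U : E n ≃ₗᵢ[ℝ] E n) (hdom : ∀ y : Y, conj ψ (U y) < ⊤) :
    minMass N (expNeg ψ) ≤ slopeMass (fun y : Y => (y : E n)) fun y => (conj ψ (U y)).toReal := by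
  have hmem : expNeg (outerLin ψ (U '' Y)) ∈ outerLogLins N (expNeg ψ) := by
    refine ⟨U '' Y, ?_, ?_, ?_, by rw [baseFun_expNeg]⟩
    · rw [baseFun_expNeg]
      rintro _ ⟨y, hy, rfl⟩
      exact hdom ⟨y, hy⟩
    · have h := Submodule.map_span (U.toLinearEquiv.toLinearMap.restrictScalars
        {c : ℝ // 0 ≤ c}) Y
      have h' : (U '' (pos Y) : Set (E n)) = pos (U '' Y) := congrArg SetLike.coe h
      rw [← h', hpos, Set.image_univ, U.surjective.range_eq]
    · exact (U.injective.encard_image Y).trans_le hN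
  refine (iInf₂_le _ hmem).trans_eq ?_
  let e : Y ≃ U '' Y := Equiv.Set.image U Y U.injective
  have hcoe : ∀ z : (U '' Y : Set (E n)), conj ψ z = ((conj ψ z).toReal : EReal) := by
    rintro ⟨_, y, hy, rfl⟩
    exact (EReal.coe_toReal (hdom ⟨y, hy⟩).ne (conj_ne_bot hx₀ _)).symm
  rw [totalMass_outerLin hcoe,
    ← slopeMass_comp_isometry (fun y : Y => (y : E n)) (fun y => (conj ψ (U y)).toReal) U]
  refine lintegral_congr fun x => ?_
  rw [← e.iInf_comp]
  rfl

/-! ### The Fenchel–Moreau inequality -/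

/-- A point below the graph is separated from the epigraph by a non-vertical or vertical
hyperplane. -/
theorem exists_separation_of_lt {n : ℕ} {φ : E n → EReal}
    (hconv : Convex ℝ {p : E n × ℝ | φ p.1 ≤ p.2}) (hclosed : IsClosed {p : E n × ℝ | φ p.1 ≤ p.2})
    {z₀ : E n} {ρ : ℝ} (hz₀ : φ z₀ ≤ ρ) {y : E n} {a : ℝ} (hya : (a : EReal) < φ y) :
    ∃ (v : E n) (s u : ℝ), 0 ≤ s ∧ inner ℝ v y + s * a < u ∧
      ∀ (z : E n) (r : ℝ), φ z ≤ r → u < inner ℝ v z + s * r := by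
  obtain ⟨f, u, hfu, hf⟩ := geometric_hahn_banach_point_closed hconv hclosed
    (x := (y, a)) (by simpa using hya)
  have hdec : ∀ (z : E n) (r : ℝ), f (z, r) =
      inner ℝ ((InnerProductSpace.toDual ℝ (E n)).symm (f.comp (.inl ℝ (E n) ℝ))) z +
        f (0, 1) * r := by
    intro z r
    rw [InnerProductSpace.toDual_symm_apply]
    have : ((z, r) : E n × ℝ) = (z, 0) + r • (0, 1) := by simp
    rw [this, map_add, map_smul]
    simp [mul_comm]
  refine ⟨_, f (0, 1), u, ?_, by rwa [← hdec], fun z r hr => by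
    rw [← hdec]; exact hf (z, r) hr⟩
  -- Were s negative, going up from (z₀, ρ) inside the epigraph would reach a point where the
  -- functional equals u exactly.
  by_contra! hs
  have h0 := hf (z₀, ρ) hz₀
  have hk : 0 ≤ (u - f (z₀, ρ)) / f (0, 1) :=
    div_nonneg_of_nonpos (by linarith) hs.le
  have h1 := hf (z₀, ρ + (u - f (z₀, ρ)) / f (0, 1))
    (hz₀.trans (by exact_mod_cast le_add_of_nonneg_right hk))
  rw [hdec, mul_add, mul_div_cancel₀ _ hs.ne, ← add_assoc, ← hdec] at h1
  linarith

/-- A closed convex function that is nowhere `-∞` is the supremum of its affine minorants. -/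
theorem exists_affine_minorant_of_lt {n : ℕ} {φ : E n → EReal} (hbot : ∀ x, φ x ≠ ⊥)
    (hconv : Convex ℝ {p : E n × ℝ | φ p.1 ≤ p.2}) (hclosed : IsClosed {p : E n × ℝ | φ p.1 ≤ p.2})
    {y : E n} {a : ℝ} (hya : (a : EReal) < φ y) :
    ∃ (v : E n) (c : ℝ), a ≤ inner ℝ v y + c ∧
      ∀ (z : E n) (r : ℝ), φ z ≤ r → inner ℝ v z + c ≤ r := by
  by_cases hdom : ∃ z₀, φ z₀ < ⊤
  swap
  · push Not at hdom
    refine ⟨0, a, by simp, fun z r hr => ?_⟩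
    exact absurd ((hdom z).trans hr) (by simp)
  obtain ⟨z₀, hz₀⟩ := hdom
  obtain ⟨ρ, hρ⟩ : ∃ ρ : ℝ, φ z₀ = ρ := ⟨_, (EReal.coe_toReal hz₀.ne (hbot z₀)).symm⟩
  obtain ⟨v, s, u, hs, hu, H⟩ := exists_separation_of_lt hconv hclosed hρ.le hya
  rcases hs.lt_or_eq with hs | rfl
  · refine ⟨-(s⁻¹ • v), s⁻¹ * u, ?_, fun z r hr => ?_⟩
    · rw [inner_neg_left, real_inner_smul_left, neg_add_eq_sub, ← mul_sub, ← div_eq_inv_mul,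
        le_div_iff₀ hs]
      linarith
    · rw [inner_neg_left, real_inner_smul_left, neg_add_eq_sub, ← mul_sub, ← div_eq_inv_mul,
        div_le_iff₀ hs]
      linarith [H z r hr]
  -- The hyperplane is vertical. Separating below z₀, where φ is finite, forces t > 0 and yields
  -- some affine minorant, with value A at y. Adding a multiple of u - ⟨v, ·⟩, negative on the
  -- domain and positive at y, keeps a minorant and lifts its value at y to at least a.
  · obtain ⟨w, t, d, ht, hd, K⟩ := exists_separation_of_lt hconv hclosed hρ.le
      (y := z₀) (a := ρ - 1) (by rw [hρ]; exact_mod_cast sub_one_lt ρ)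
    have ht0 : 0 < t := by linarith [K z₀ ρ hρ.le]
    set A : ℝ := inner ℝ (-(t⁻¹ • w)) y + t⁻¹ * d with hA
    have hu' : 0 < u - inner ℝ v y := by linarith
    refine ⟨-(t⁻¹ • w) - max 0 ((a - A) / (u - inner ℝ v y)) • v,
      t⁻¹ * d + max 0 ((a - A) / (u - inner ℝ v y)) * u, ?_, fun z r hr => ?_⟩
    · rw [inner_sub_left, real_inner_smul_left]
      have h1 := mul_le_mul_of_nonneg_right (le_max_right 0 ((a - A) / (u - inner ℝ v y))) hu'.le
      rw [div_mul_cancel₀ _ hu'.ne'] at h1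
      linarith
    · have h1 : inner ℝ (-(t⁻¹ • w)) z + t⁻¹ * d ≤ r := by
        rw [inner_neg_left, real_inner_smul_left, neg_add_eq_sub, ← mul_sub, ← div_eq_inv_mul,
          div_le_iff₀ ht0]
        linarith [K z r hr]
      have h2 := mul_nonneg (le_max_left 0 ((a - A) / (u - inner ℝ v y)))
        (show 0 ≤ inner ℝ v z - u by linarith [H z r hr])
      rw [inner_sub_left, real_inner_smul_left]
      linarith

theorem le_conj_conj {n : ℕ} {φ : E n → EReal} (hbot : ∀ x, φ x ≠ ⊥)
    (hconv : Convex ℝ {p : E n × ℝ | φ p.1 ≤ p.2}) (hclosed : IsClosed {p : E n × ℝ | φ p.1 ≤ p.2})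
    (y : E n) : φ y ≤ conj (conj φ) y := by
  refine EReal.ge_of_forall_gt_iff_ge.1 fun a ha => ?_
  obtain ⟨v, c, hac, H⟩ := exists_affine_minorant_of_lt hbot hconv hclosed ha
  have h1 : conj φ v ≤ ((-c : ℝ) : EReal) := conj_le_coe_iff.2 fun z =>
    EReal.le_of_forall_lt_iff_le.1 fun r hr => by
      have := H z r hr.le
      rw [real_inner_comm, sub_neg_eq_add]
      exact_mod_cast this
  have h2 : ((inner ℝ y v : ℝ) : EReal) - conj φ v ≤ conj (conj φ) y :=
    le_iSup (fun x => ((inner ℝ y x : ℝ) : EReal) - conj φ x) v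
  refine le_trans ?_ h2
  calc (a : EReal) ≤ ((inner ℝ y v - (-c) : ℝ) : EReal) := by
        rw [real_inner_comm, sub_neg_eq_add]; exact_mod_cast hac
    _ ≤ _ := by rw [EReal.coe_sub]; exact EReal.sub_le_sub le_rfl h1

/-! ### Rotations -/

/-- A rotation as a linear isometry. -/
def rotateIsometry {n : ℕ} (ϑ : SO n) : E n ≃ₗᵢ[ℝ] E n :=
  LinearIsometry.toLinearIsometryEquiv
    { toLinearMap := Matrix.toEuclideanLin (ϑ : Matrix (Fin n) (Fin n) ℝ)
      norm_map' := fun x => by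
        have h := Matrix.mem_unitaryGroup_iff'.1 (Matrix.mem_specialUnitaryGroup_iff.1 ϑ.2).1
        rw [Matrix.star_eq_conjTranspose, Matrix.conjTranspose_eq_transpose_of_trivial] at h
        rw [@norm_eq_sqrt_real_inner _ _ _ x, @norm_eq_sqrt_real_inner,
          ← LinearMap.adjoint_inner_right, ← Matrix.toEuclideanLin_conjTranspose_eq_adjoint,
          ← LinearMap.comp_apply]
        congr 2
        simp [Matrix.toLpLin_apply, h] } rfl

theorem rotateIsometry_apply {n : ℕ} (ϑ : SO n) (x : E n) : rotateIsometry ϑ x = rotate ϑ x := rfl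

theorem continuous_rotate_inv {n : ℕ} (x : E n) : Continuous fun ϑ : SO n => rotate ϑ⁻¹ x := by
  have h : Continuous fun A : Matrix (Fin n) (Fin n) ℝ => Matrix.toEuclideanLin A x := by
    simp only [Matrix.toLpLin_apply]
    exact (PiLp.continuous_toLp 2 _).comp (Continuous.matrix_mulVec continuous_id continuous_const)
  exact h.comp (continuous_subtype_val.comp continuous_inv)

/-! ### Integrals of functions bounded from below -/

/-- Integrates the pointwise identity (g + M)⁺ + g⁻ = g⁺ + M, valid for g ≥ -M. -/
theorem lintegral_add_const_eq {α : Type*} [MeasurableSpace α] (μ : Measure α)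
    [IsProbabilityMeasure μ] {g : α → EReal} (hg : Measurable g) {M : ℝ} (hM : 0 ≤ M)
    (hgM : ∀ a, ((-M : ℝ) : EReal) ≤ g a) :
    ∫⁻ a, (g a + M).toENNReal ∂μ + ∫⁻ a, (-g a).toENNReal ∂μ =
      ∫⁻ a, (g a).toENNReal ∂μ + ENNReal.ofReal M := by
  have h1 : ENNReal.ofReal M = ∫⁻ _, ENNReal.ofReal M ∂μ := by simp
  have h2 : Measurable fun a => (-g a).toENNReal := hg.neg.ereal_toENNReal
  rw [h1, ← lintegral_add_right _ h2,
    ← lintegral_add_right _ measurable_const]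
  refine lintegral_congr fun a => ?_
  have := hgM a
  induction h : g a with
  | bot => simp [h] at this
  | top => simp
  | coe z =>
    rw [h] at this
    have hz : -M ≤ z := by exact_mod_cast this
    rw [← EReal.coe_add, ← EReal.coe_neg, EReal.real_coe_toENNReal, EReal.real_coe_toENNReal,
      EReal.real_coe_toENNReal]
    rcases le_total 0 z with h0 | h0
    · rw [ENNReal.ofReal_of_nonpos (p := -z) (by linarith), ENNReal.ofReal_add h0 hM, add_zero]
    · rw [ENNReal.ofReal_of_nonpos h0, ← ENNReal.ofReal_add (by linarith) (by linarith), zero_add]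
      congr 1; ring

/-- Trades a difference of integrals for one integral of a nonnegative function, to which linearity
and Fatou apply. The condition -M ≤ r is separate because `ENNReal.ofReal` truncates at 0. -/
theorem erealIntegral_le_coe_iff {α : Type*} [MeasurableSpace α] (μ : Measure α)
    [IsProbabilityMeasure μ] {g : α → EReal} (hg : Measurable g) {M : ℝ} (hM : 0 ≤ M)
    (hgM : ∀ a, ((-M : ℝ) : EReal) ≤ g a) {r : ℝ} :
    erealIntegral μ g ≤ r ↔ -M ≤ r ∧ ∫⁻ a, (g a + M).toENNReal ∂μ ≤ ENNReal.ofReal (r + M) := by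
  have key := lintegral_add_const_eq μ hg hM hgM
  have hN : ∫⁻ a, (-g a).toENNReal ∂μ ≤ ENNReal.ofReal M := by
    calc _ ≤ ∫⁻ _, ENNReal.ofReal M ∂μ := lintegral_mono fun a => by
          rw [← EReal.real_coe_toENNReal]
          refine EReal.toENNReal_le_toENNReal ?_
          have := hgM a
          rwa [EReal.coe_neg, EReal.neg_le] at this
      _ = _ := by simp
  rw [erealIntegral]
  generalize ∫⁻ a, (-g a).toENNReal ∂μ = q at *
  generalize ∫⁻ a, (g a).toENNReal ∂μ = p at *
  generalize ∫⁻ a, (g a + M).toENNReal ∂μ = i at *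
  lift q to NNReal using ne_top_of_le_ne_top ENNReal.ofReal_ne_top hN
  have hq : (q : ℝ) ≤ M := by
    have h := ENNReal.toReal_mono ENNReal.ofReal_ne_top hN
    rwa [ENNReal.toReal_ofReal hM, ENNReal.coe_toReal] at h
  induction p with
  | top =>
    have hi : i = ⊤ := by
      by_contra h
      exact (ENNReal.add_ne_top.2 ⟨h, ENNReal.coe_ne_top⟩) (by rw [key]; simp)
    subst hi
    simp
  | coe p =>
    have hi : i ≠ ⊤ := fun h => by
      subst h; rw [top_add] at key
      exact ENNReal.add_ne_top.2 ⟨ENNReal.coe_ne_top, ENNReal.ofReal_ne_top⟩ key.symm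
    lift i to NNReal using hi
    have key' : (i : ℝ) + q = p + M := by
      have h := congrArg ENNReal.toReal key
      rwa [ENNReal.toReal_add ENNReal.coe_ne_top ENNReal.coe_ne_top,
        ENNReal.toReal_add ENNReal.coe_ne_top ENNReal.ofReal_ne_top,
        ENNReal.toReal_ofReal hM] at h
    have h1 : ((p : ℝ≥0∞) : EReal) - ((q : ℝ≥0∞) : EReal) ≤ (r : EReal) ↔ (p : ℝ) - q ≤ r := by
      change ((p : ℝ) : EReal) - ((q : ℝ) : EReal) ≤ _ ↔ _
      norm_cast
    rw [h1]
    constructor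
    · intro h
      have hp := p.2
      refine ⟨by linarith [p.coe_nonneg], ?_⟩
      rw [ENNReal.le_ofReal_iff_toReal_le ENNReal.coe_ne_top (by linarith [p.coe_nonneg]),
        ENNReal.coe_toReal]
      linarith
    · rintro ⟨h2, h3⟩
      rw [ENNReal.le_ofReal_iff_toReal_le ENNReal.coe_ne_top (by linarith),
        ENNReal.coe_toReal] at h3
      linarith

theorem continuous_add_const_toENNReal (M : ℝ) :
    Continuous fun e : EReal => (e + M).toENNReal :=
  EReal.continuous_toENNReal.comp <| continuous_iff_continuousAt.2 fun e =>
    (EReal.continuousAt_add (p := (e, (M : EReal))) (by simp) (by simp)).comp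
      (f := fun e : EReal => (e, (M : EReal))) (by fun_prop)

/-- If the extended integral of a function that is bounded from below is at most `t`, then the
function is integrable with integral at most `t`. -/
theorem integrable_toReal_of_erealIntegral_le {α : Type*} [MeasurableSpace α] (μ : Measure α)
    [IsProbabilityMeasure μ] {g : α → EReal} (hg : Measurable g) {M : ℝ} (hM : 0 ≤ M)
    (hgM : ∀ a, ((-M : ℝ) : EReal) ≤ g a) {t : ℝ} (ht : erealIntegral μ g ≤ t) :
    (∀ᵐ a ∂μ, g a < ⊤) ∧ Integrable (fun a => (g a).toReal) μ ∧ ∫ a, (g a).toReal ∂μ ≤ t := by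
  obtain ⟨hMt, hI⟩ := (erealIntegral_le_coe_iff μ hg hM hgM).1 ht
  have hmeas : Measurable fun a => (g a + M).toENNReal :=
    (continuous_add_const_toENNReal M).measurable.comp hg
  have hfin : ∀ᵐ a ∂μ, g a < ⊤ := by
    filter_upwards [ae_lt_top hmeas (ne_top_of_le_ne_top ENNReal.ofReal_ne_top hI)] with a ha
    refine lt_top_iff_ne_top.2 fun h => ?_
    simp [h] at ha
  have hnn : ∀ᵐ a ∂μ, 0 ≤ (g a).toReal + M := by
    filter_upwards [hfin] with a ha
    have := EReal.toReal_le_toReal (hgM a) (by simp) ha.ne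
    rw [EReal.toReal_coe] at this
    linarith
  have heq : ∫⁻ a, ENNReal.ofReal ((g a).toReal + M) ∂μ = ∫⁻ a, (g a + M).toENNReal ∂μ := by
    refine lintegral_congr_ae ?_
    filter_upwards [hfin] with a ha
    have hb : g a ≠ ⊥ := fun h => by simpa [h] using hgM a
    rw [← EReal.real_coe_toENNReal, EReal.coe_add, EReal.coe_toReal ha.ne hb]
  have hm' : Measurable fun a => (g a).toReal + M := hg.ereal_toReal.add_const M
  have hint : Integrable (fun a => (g a).toReal + M) μ := by
    refine ⟨hm'.aestronglyMeasurable, ?_⟩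
    rw [hasFiniteIntegral_iff_ofReal hnn, heq]
    exact hI.trans_lt ENNReal.ofReal_lt_top
  have hint' : Integrable (fun a => (g a).toReal) μ := by
    exact (hint.sub (integrable_const M)).congr (Filter.Eventually.of_forall fun a => by simp)
  refine ⟨hfin, hint', ?_⟩
  have h1 : ∫ a, ((g a).toReal + M) ∂μ ≤ t + M := by
    rw [integral_eq_lintegral_of_nonneg_ae hnn hm'.aestronglyMeasurable, heq]
    exact ENNReal.toReal_le_of_le_ofReal (by linarith) hI
  rw [integral_add hint' (integrable_const M)] at h1
  simpa using h1

/-! ### The rotational average of the conjugate -/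

/-- Cauchy–Schwarz at one point of the domain. The bound sees z only through its norm, so it is
uniform over rotations. -/
theorem neg_le_conj {n : ℕ} {ψ : E n → EReal} {x₀ : E n} {ρ : ℝ} (h : ψ x₀ = ρ) (z : E n) :
    ((-(‖z‖ * ‖x₀‖ + |ρ|) : ℝ) : EReal) ≤ conj ψ z := by
  have h1 : ((inner ℝ z x₀ : ℝ) : EReal) - ψ x₀ ≤ conj ψ z :=
    le_iSup (fun x => ((inner ℝ z x : ℝ) : EReal) - ψ x) x₀
  refine le_trans ?_ h1
  rw [h, ← EReal.coe_sub, EReal.coe_le_coe_iff]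
  have := neg_le_of_abs_le (abs_real_inner_le_norm z x₀)
  linarith [le_abs_self ρ]

theorem lowerSemicontinuous_conj {n : ℕ} (ψ : E n → EReal) : LowerSemicontinuous (conj ψ) := by
  refine lowerSemicontinuous_iSup fun x => Continuous.lowerSemicontinuous ?_
  have hc : Continuous fun z : E n => ((inner ℝ z x : ℝ) : EReal) :=
    continuous_coe_real_ereal.comp (by fun_prop)
  refine continuous_iff_continuousAt.2 fun z => ?_
  simp only [sub_eq_add_neg]
  exact (EReal.continuousAt_add (p := (((inner ℝ z x : ℝ) : EReal), -ψ x)) (by simp) (by simp)).comp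
    (f := fun z : E n => (((inner ℝ z x : ℝ) : EReal), -ψ x)) (hc.prodMk continuous_const).continuousAt

theorem conj_convex {n : ℕ} {ψ : E n → EReal} {y z : E n} {p q a b : ℝ} (ha : 0 ≤ a) (hb : 0 ≤ b)
    (hab : a + b = 1) (hp : conj ψ y ≤ p) (hq : conj ψ z ≤ q) :
    conj ψ (a • y + b • z) ≤ ((a * p + b * q : ℝ) : EReal) := by
  rw [conj_le_coe_iff] at *
  intro x
  have h1 := hp x
  have h2 := hq x
  rw [inner_add_right, real_inner_smul_right, real_inner_smul_right]
  induction h : ψ x with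
  | bot => exact absurd (le_bot_iff.1 (h ▸ h1)) (EReal.coe_ne_bot _)
  | top => simp
  | coe w =>
    rw [h, EReal.coe_le_coe_iff] at h1 h2
    rw [EReal.coe_le_coe_iff]
    have h3 := mul_le_mul_of_nonneg_left h1 ha
    have h4 := mul_le_mul_of_nonneg_left h2 hb
    have h5 : a * w + b * w = w := by rw [← add_mul, hab, one_mul]
    linarith

/-- The conjugate, shifted by a constant and cut off at `0`. -/
def shiftConj {n : ℕ} (ψ : E n → EReal) (M : ℝ) (y : E n) : ℝ≥0∞ := (conj ψ y + M).toENNReal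

theorem lowerSemicontinuous_shiftConj {n : ℕ} (ψ : E n → EReal) (M : ℝ) :
    LowerSemicontinuous (shiftConj ψ M) :=
  (continuous_add_const_toENNReal M).comp_lowerSemicontinuous (lowerSemicontinuous_conj ψ)
    fun _ _ h => EReal.toENNReal_le_toENNReal (add_le_add_left h _)

theorem shiftConj_convex {n : ℕ} {ψ : E n → EReal} {x₀ : E n} (hx₀ : ψ x₀ < ⊤) (M : ℝ)
    {a b : ℝ} (ha : 0 < a) (hb : 0 < b) (hab : a + b = 1) (y z : E n) :
    shiftConj ψ M (a • y + b • z) ≤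
      ENNReal.ofReal a * shiftConj ψ M y + ENNReal.ofReal b * shiftConj ψ M z := by
  have ha' : ENNReal.ofReal a ≠ 0 := by simpa using ha
  have hb' : ENNReal.ofReal b ≠ 0 := by simpa using hb
  unfold shiftConj
  induction hp : conj ψ y with
  | bot => exact absurd hp (conj_ne_bot hx₀ y)
  | top => simp [ENNReal.mul_top ha']
  | coe p =>
    induction hq : conj ψ z with
    | bot => exact absurd hq (conj_ne_bot hx₀ z)
    | top => simp [ENNReal.mul_top hb']
    | coe q =>
      have h := conj_convex ha.le hb.le hab hp.le hq.le
      calc _ ≤ (((a * p + b * q : ℝ) : EReal) + M).toENNReal :=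
            EReal.toENNReal_le_toENNReal (add_le_add_left h _)
        _ = ENNReal.ofReal (a * (p + M) + b * (q + M)) := by
            rw [← EReal.coe_add, EReal.real_coe_toENNReal]
            congr 1
            have h5 : a * M + b * M = M := by rw [← add_mul, hab, one_mul]
            linarith
        _ ≤ _ := by
            refine ENNReal.ofReal_add_le.trans ?_
            rw [← EReal.coe_add, ← EReal.coe_add, EReal.real_coe_toENNReal,
              EReal.real_coe_toENNReal, ENNReal.ofReal_mul ha.le, ENNReal.ofReal_mul hb.le]

theorem norm_rotate {n : ℕ} (ϑ : SO n) (x : E n) : ‖rotate ϑ x‖ = ‖x‖ :=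
  (rotateIsometry ϑ).norm_map x

theorem measurable_conj_rotate {n : ℕ} (ψ : E n → EReal) (y : E n) :
    Measurable fun ϑ : SO n => conj ψ (rotate ϑ⁻¹ y) :=
  (lowerSemicontinuous_conj ψ).measurable.comp (continuous_rotate_inv y).measurable

theorem measurable_shiftConj_rotate {n : ℕ} (ψ : E n → EReal) (M : ℝ) (y : E n) :
    Measurable fun ϑ : SO n => shiftConj ψ M (rotate ϑ⁻¹ y) :=
  (lowerSemicontinuous_shiftConj ψ M).measurable.comp (continuous_rotate_inv y).measurable

theorem neg_le_conj_rotate {n : ℕ} {ψ : E n → EReal} {x₀ : E n} {ρ M : ℝ} (h : ψ x₀ = ρ)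
    {y : E n} (hM : ‖y‖ * ‖x₀‖ + |ρ| ≤ M) (ϑ : SO n) :
    ((-M : ℝ) : EReal) ≤ conj ψ (rotate ϑ⁻¹ y) := by
  refine le_trans ?_ (neg_le_conj h _)
  rw [norm_rotate, EReal.coe_le_coe_iff]
  linarith

theorem rotConj_le_coe_iff {n : ℕ} {ψ : E n → EReal} {x₀ : E n} {ρ M : ℝ} (h : ψ x₀ = ρ)
    {y : E n} (hM : ‖y‖ * ‖x₀‖ + |ρ| ≤ M) {r : ℝ} :
    rotConj ψ y ≤ r ↔
      -M ≤ r ∧ ∫⁻ ϑ, shiftConj ψ M (rotate ϑ⁻¹ y) ∂haarSO n ≤ ENNReal.ofReal (r + M) :=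
  erealIntegral_le_coe_iff _ (measurable_conj_rotate ψ y) (le_trans (by positivity) hM)
    (neg_le_conj_rotate h hM)

theorem rotConj_ne_bot {n : ℕ} {ψ : E n → EReal} {x₀ : E n} {ρ : ℝ} (h : ψ x₀ = ρ) (y : E n) :
    rotConj ψ y ≠ ⊥ := by
  intro hy
  have h1 := ((rotConj_le_coe_iff h le_rfl (y := y) (r := -(‖y‖ * ‖x₀‖ + |ρ|) - 1)).1
    (by simp [hy])).1
  linarith

theorem convex_epigraph_rotConj {n : ℕ} {ψ : E n → EReal} {x₀ : E n} {ρ : ℝ} (h : ψ x₀ = ρ) :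
    Convex ℝ {p : E n × ℝ | rotConj ψ p.1 ≤ p.2} := by
  refine convex_iff_forall_pos.2 ?_
  rintro ⟨y, r⟩ hy ⟨z, s⟩ hz a b ha hb hab
  simp only [Set.mem_ofPred_eq, Prod.smul_mk, Prod.mk_add_mk] at *
  -- A single shift valid at y, z and their combination.
  obtain ⟨M, hM⟩ : ∃ M, M = max (max (‖y‖ * ‖x₀‖ + |ρ|) (‖z‖ * ‖x₀‖ + |ρ|))
    (‖a • y + b • z‖ * ‖x₀‖ + |ρ|) := ⟨_, rfl⟩
  rw [rotConj_le_coe_iff h (M := M) (hM ▸ (le_max_left _ _).trans (le_max_left _ _))] at hy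
  rw [rotConj_le_coe_iff h (M := M) (hM ▸ (le_max_right _ _).trans (le_max_left _ _))] at hz
  rw [rotConj_le_coe_iff h (M := M) (hM ▸ le_max_right _ _)]
  have hM1 : a * M + b * M = M := by rw [← add_mul, hab, one_mul]
  have hr : 0 ≤ a * (r + M) := mul_nonneg ha.le (by linarith)
  have hs : 0 ≤ b * (s + M) := mul_nonneg hb.le (by linarith)
  refine ⟨by simp only [smul_eq_mul]; linarith, ?_⟩
  have hψ : ψ x₀ < ⊤ := h ▸ EReal.coe_lt_top ρ
  calc ∫⁻ ϑ, shiftConj ψ M (rotate ϑ⁻¹ (a • y + b • z)) ∂haarSO n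
      ≤ ∫⁻ ϑ, (ENNReal.ofReal a * shiftConj ψ M (rotate ϑ⁻¹ y) +
          ENNReal.ofReal b * shiftConj ψ M (rotate ϑ⁻¹ z)) ∂haarSO n := by
        refine lintegral_mono fun ϑ => ?_
        have := shiftConj_convex hψ M ha hb hab (rotate ϑ⁻¹ y) (rotate ϑ⁻¹ z)
        simpa only [← rotateIsometry_apply, map_add, map_smul] using this
    _ = ENNReal.ofReal a * ∫⁻ ϑ, shiftConj ψ M (rotate ϑ⁻¹ y) ∂haarSO n +
          ENNReal.ofReal b * ∫⁻ ϑ, shiftConj ψ M (rotate ϑ⁻¹ z) ∂haarSO n := by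
        rw [lintegral_add_left ((measurable_shiftConj_rotate ψ M y).const_mul _),
          lintegral_const_mul _ (measurable_shiftConj_rotate ψ M y),
          lintegral_const_mul _ (measurable_shiftConj_rotate ψ M z)]
    _ ≤ ENNReal.ofReal a * ENNReal.ofReal (r + M) + ENNReal.ofReal b * ENNReal.ofReal (s + M) := by
        gcongr
        exacts [hy.2, hz.2]
    _ = ENNReal.ofReal (a • r + b • s + M) := by
        rw [← ENNReal.ofReal_mul ha.le, ← ENNReal.ofReal_mul hb.le, ← ENNReal.ofReal_add hr hs]
        congr 1
        simp only [smul_eq_mul]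
        linarith

/-- Lower semicontinuity of the integrand plus Fatou; a convergent sequence is bounded, so one shift
M serves all its terms. -/
theorem isClosed_epigraph_rotConj {n : ℕ} {ψ : E n → EReal} {x₀ : E n} {ρ : ℝ} (h : ψ x₀ = ρ) :
    IsClosed {p : E n × ℝ | rotConj ψ p.1 ≤ p.2} := by
  refine IsSeqClosed.isClosed ?_
  intro u p hu hup
  have h1 : Filter.Tendsto (fun k => (u k).1) Filter.atTop (nhds p.1) :=
    (continuous_fst.tendsto p).comp hup
  have h2 : Filter.Tendsto (fun k => (u k).2) Filter.atTop (nhds p.2) :=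
    (continuous_snd.tendsto p).comp hup
  obtain ⟨R, hR⟩ := h1.norm.bddAbove_range
  have hRk : ∀ k, ‖(u k).1‖ ≤ R := fun k => hR ⟨k, rfl⟩
  have hRp : ‖p.1‖ ≤ R := le_of_tendsto' h1.norm hRk
  have hM : ∀ y : E n, ‖y‖ ≤ R → ‖y‖ * ‖x₀‖ + |ρ| ≤ R * ‖x₀‖ + |ρ| := fun y hy => by gcongr
  have hk : ∀ k, _ := fun k => (rotConj_le_coe_iff h (hM _ (hRk k))).1 (hu k)
  refine (rotConj_le_coe_iff h (hM _ hRp)).2 ⟨ge_of_tendsto' h2 fun k => (hk k).1, ?_⟩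
  set M := R * ‖x₀‖ + |ρ|
  calc ∫⁻ ϑ, shiftConj ψ M (rotate ϑ⁻¹ p.1) ∂haarSO n
      ≤ ∫⁻ ϑ, Filter.liminf (fun k => shiftConj ψ M (rotate ϑ⁻¹ (u k).1)) Filter.atTop
          ∂haarSO n := by
        refine lintegral_mono fun ϑ => ?_
        have hc : Filter.Tendsto (fun k => rotate ϑ⁻¹ (u k).1) Filter.atTop
            (nhds (rotate ϑ⁻¹ p.1)) := ((rotateIsometry ϑ⁻¹).continuous.tendsto p.1).comp h1
        exact ((lowerSemicontinuous_shiftConj ψ M).le_liminf _).trans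
          (Filter.liminf_le_liminf_of_le hc)
    _ ≤ Filter.liminf (fun k => ∫⁻ ϑ, shiftConj ψ M (rotate ϑ⁻¹ (u k).1) ∂haarSO n)
          Filter.atTop := lintegral_liminf_le fun k => measurable_shiftConj_rotate ψ M _
    _ ≤ Filter.liminf (fun k => ENNReal.ofReal ((u k).2 + M)) Filter.atTop :=
        Filter.liminf_le_liminf (Filter.Eventually.of_forall fun k => (hk k).2)
    _ = ENNReal.ofReal (p.2 + M) :=
        ((ENNReal.continuous_ofReal.tendsto _).comp (h2.add_const M)).liminf_eq

theorem rotConj_le_conj_conj {n : ℕ} {ψ : E n → EReal} {x₀ : E n} {ρ : ℝ} (h : ψ x₀ = ρ) (y : E n) :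
    rotConj ψ y ≤ conj (conj (rotConj ψ)) y :=
  le_conj_conj (rotConj_ne_bot h) (convex_epigraph_rotConj h) (isClosed_epigraph_rotConj h) y

/-! ### The one-dimensional symmetrization -/

/-- Conjugation turns infimal convolution into a sum, so the conjugate here averages Lψ(y) and
Lψ(-y). A finite upper bound on it makes both terms finite. -/
theorem conj_half_infConv_le {n : ℕ} {ψ : E n → EReal} (hbot : ∀ x, ψ x ≠ ⊥) {x₀ : E n}
    (hx₀ : ψ x₀ < ⊤) {y : E n} {t : ℝ}
    (ht : conj (epiMul (1 / 2) (infConv ψ fun x => ψ (-x))) y ≤ t) :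
    ∃ p q : ℝ, conj ψ y = p ∧ conj ψ (-y) = q ∧ (p + q) / 2 ≤ t := by
  rw [conj_le_coe_iff] at ht
  -- Evaluate at (u - w)/2, splitting u - w as u + (-w) in the infimal convolution.
  have key : ∀ (u w : E n) (α β : ℝ), ψ u = α → ψ w = β →
      inner ℝ u y - α + (inner ℝ w (-y) - β) ≤ 2 * t := by
    intro u w α β hu hw
    have h1 : infConv ψ (fun x => ψ (-x)) (u - w) ≤ ((α + β : ℝ) : EReal) := by
      refine (iInf_le _ (-w)).trans ?_
      simp [hu, hw]
    have h2 := ht ((1 / 2 : ℝ) • (u - w))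
    have h3 : epiMul (1 / 2) (infConv ψ fun x => ψ (-x)) ((1 / 2 : ℝ) • (u - w)) ≤
        ((1 / 2 * (α + β) : ℝ) : EReal) := by
      rw [epiMul, smul_smul, inv_mul_cancel₀ (by norm_num), one_smul, EReal.coe_mul]
      exact mul_le_mul_of_nonneg_left h1 (by exact_mod_cast (by norm_num : (0 : ℝ) ≤ 1 / 2))
    have h4 := EReal.coe_le_coe_iff.1 (h2.trans h3)
    rw [real_inner_smul_left, inner_sub_left] at h4
    rw [inner_neg_right]
    linarith
  obtain ⟨ρ, hρ⟩ : ∃ ρ : ℝ, ψ x₀ = ρ := ⟨_, (EReal.coe_toReal hx₀.ne (hbot x₀)).symm⟩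
  have hsup : ∀ (z : E n) (c : ℝ), (∀ u α, ψ u = ((α : ℝ) : EReal) → inner ℝ u z - α ≤ c) →
      conj ψ z ≤ c := by
    intro z c hc
    refine conj_le_coe_iff.2 fun u => ?_
    induction hu : ψ u with
    | bot => exact absurd hu (hbot u)
    | top => simp
    | coe α =>
      rw [EReal.coe_le_coe_iff]
      linarith [hc u α hu]
  have hreal : ∀ (z : E n) (c : ℝ), conj ψ z ≤ c → ∃ p : ℝ, conj ψ z = p := fun z c hc =>
    ⟨_, (EReal.coe_toReal (ne_top_of_le_ne_top (EReal.coe_ne_top c) hc) (conj_ne_bot hx₀ z)).symm⟩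
  have hle : ∀ (z : E n) (p : ℝ), conj ψ z = p → ∀ u α, ψ u = ((α : ℝ) : EReal) →
      inner ℝ u z - α ≤ p := by
    intro z p hp u α hu
    have := conj_le_coe_iff.1 hp.le u
    rw [hu, EReal.coe_le_coe_iff] at this
    linarith
  -- Fixing w = x₀ shows Lψ(y) finite; afterwards the suprema over u and then over w are taken in
  -- turn.
  obtain ⟨p, hp⟩ := hreal y _ (hsup y (2 * t - (inner ℝ x₀ (-y) - ρ)) fun u α hu => by
    linarith [key u x₀ α ρ hu hρ])
  have hq' : conj ψ (-y) ≤ ((2 * t - p : ℝ) : EReal) := hsup _ _ fun w β hw => by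
    have : conj ψ y ≤ ((2 * t - (inner ℝ w (-y) - β) : ℝ) : EReal) := hsup _ _ fun u α hu => by
      linarith [key u w α β hu hw]
    rw [hp, EReal.coe_le_coe_iff] at this
    linarith
  obtain ⟨q, hq⟩ := hreal (-y) _ hq'
  refine ⟨p, q, hp, hq, ?_⟩
  rw [hq, EReal.coe_le_coe_iff] at hq'
  linarith

/-! ### The main inequality -/

/-- Both Y and -Y are admissible for ψ, and the midpoint of their two value vectors stays in the
convex superlevel set. -/
theorem minMass_le_slopeMass_of_infConv {n N : ℕ} {ψ : E n → EReal} (hbot : ∀ x, ψ x ≠ ⊥)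
    {x₀ : E n} (hx₀ : ψ x₀ < ⊤) {Y : Set (E n)} (hpos : pos Y = Set.univ) (hN : Y.encard ≤ N)
    [Fintype Y] {t : Y → ℝ}
    (ht : ∀ y : Y, conj (epiMul (1 / 2) (infConv ψ fun x => ψ (-x))) y ≤ t y) :
    minMass N (expNeg ψ) ≤ slopeMass (fun y : Y => (y : E n)) t := by
  choose p q hp hq hpq using fun y : Y => conj_half_infConv_le hbot hx₀ (ht y)
  have h1 : minMass N (expNeg ψ) ≤ slopeMass (fun y : Y => (y : E n)) p := by
    have h := minMass_le_slopeMass hx₀ hpos hN (LinearIsometryEquiv.refl ℝ (E n))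
      fun y => by simp [hp]
    simpa [hp] using h
  have h2 : minMass N (expNeg ψ) ≤ slopeMass (fun y : Y => (y : E n)) q := by
    have h := minMass_le_slopeMass hx₀ hpos hN (LinearIsometryEquiv.neg ℝ)
      fun y => by simp [hq]
    simpa [hq] using h
  have h3 := convex_setOf_le_slopeMass (fun y : Y => (y : E n)) (minMass N (expNeg ψ)) h1 h2
    (a := 1 / 2) (b := 1 / 2) (by norm_num) (by norm_num) (by norm_num)
  refine le_trans h3 ?_
  have h4 := slopeMass_le_exp_mul (fun y : Y => (y : E n))
    (s := (1 / 2 : ℝ) • p + (1 / 2 : ℝ) • q) (t := t) (ε := 0) fun y => by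
      have := hpq y
      simp only [Pi.add_apply, Pi.smul_apply, smul_eq_mul]
      linarith
  simpa using h4

/-- Jensen's inequality for the superlevel sets of `slopeMass`. -/
theorem le_slopeMass_integral {n : ℕ} {ι Ω : Type*} [Fintype ι] [MeasurableSpace Ω]
    {μ : Measure Ω} [IsProbabilityMeasure μ] {v : ι → E n} {m : ℝ≥0∞} {S : Ω → ι → ℝ}
    (hS : ∀ i, Integrable (fun ω => S ω i) μ) (h : ∀ᵐ ω ∂μ, m ≤ slopeMass v (S ω)) :
    m ≤ slopeMass v fun i => ∫ ω, S ω i ∂μ := by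
  have hI : ∫ ω, S ω ∂μ ∈ {t : ι → ℝ | m ≤ slopeMass v t} :=
    (convex_setOf_le_slopeMass v m).integral_mem (isClosed_setOf_le_slopeMass v m) h
      (Integrable.of_eval hS)
  have heq : ∫ ω, S ω ∂μ = fun i => ∫ ω, S ω i ∂μ := funext fun i => eval_integral hS i
  rw [heq] at hI
  exact hI

/-- Finite averages force Lψ(ϑ⁻¹y) < ∞ for almost every ϑ, simultaneously for the finitely many y;
then Jensen and monotonicity apply. -/
theorem minMass_le_slopeMass_of_rotConj {n N : ℕ} {ψ : E n → EReal} {x₀ : E n} {ρ : ℝ}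
    (hρ : ψ x₀ = ρ) {Y : Set (E n)} (hpos : pos Y = Set.univ) (hN : Y.encard ≤ N)
    [Fintype Y] {t : Y → ℝ} (ht : ∀ y : Y, rotConj ψ y ≤ t y) :
    minMass N (expNeg ψ) ≤ slopeMass (fun y : Y => (y : E n)) t := by
  have hx₀ : ψ x₀ < ⊤ := hρ ▸ EReal.coe_lt_top ρ
  have hint : ∀ y : Y, (∀ᵐ ϑ ∂haarSO n, conj ψ (rotate ϑ⁻¹ (y : E n)) < ⊤) ∧
      Integrable (fun ϑ => (conj ψ (rotate ϑ⁻¹ (y : E n))).toReal) (haarSO n) ∧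
      ∫ ϑ, (conj ψ (rotate ϑ⁻¹ (y : E n))).toReal ∂haarSO n ≤ t y := fun y =>
    integrable_toReal_of_erealIntegral_le (haarSO n) (measurable_conj_rotate ψ (y : E n))
      (M := ‖(y : E n)‖ * ‖x₀‖ + |ρ|) (by positivity) (neg_le_conj_rotate hρ le_rfl) (ht y)
  have hmem : ∀ᵐ ϑ ∂haarSO n, minMass N (expNeg ψ) ≤
      slopeMass (fun y : Y => (y : E n)) fun y => (conj ψ (rotate ϑ⁻¹ (y : E n))).toReal := by
    filter_upwards [ae_all_iff.2 fun y : Y => (hint y).1] with ϑ hϑ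
    exact minMass_le_slopeMass hx₀ hpos hN (rotateIsometry ϑ⁻¹) hϑ
  refine (le_slopeMass_integral (fun y => (hint y).2.1) hmem).trans ?_
  simpa using slopeMass_le_exp_mul (fun y : Y => (y : E n)) (ε := 0) fun y => by
    simpa using (hint y).2.2

end OuterLin

end

open OuterLin in
theorem mainTheorem8 (n N : ℕ) (hn : 1 ≤ n) (hN : n + 1 ≤ N)
    (f : OuterLin.E n → ENNReal) (hf : f ∈ OuterLin.LCc n) :
    OuterLin.minMass N f ≤ OuterLin.minMass N (OuterLin.hypoSymm f) := by
  obtain ⟨ψ, hψ, rfl⟩ := hf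
  obtain ⟨x₀, hx₀⟩ := hψ.proper
  obtain ⟨ρ, hρ⟩ : ∃ ρ : ℝ, ψ x₀ = ρ := ⟨_, (EReal.coe_toReal hx₀.ne (hψ.ne_bot x₀)).symm⟩
  refine le_iInf₂ fun p hp => ?_
  obtain ⟨Y, hdom, hpos, hY, rfl⟩ := hp
  rw [hypoSymm, baseFun_expNeg, baseFun_expNeg] at *
  have := (Set.finite_of_encard_le_coe hY).fintype
  have hcoe : ∀ y : Y, conj (rotEpiSymm ψ) y ≠ ⊥ →
      conj (rotEpiSymm ψ) y = ((conj (rotEpiSymm ψ) y).toReal : EReal) := fun y hy =>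
    (EReal.coe_toReal (hdom y.2).ne hy).symm
  by_cases h1 : n = 1
  · rw [rotEpiSymm, if_pos h1] at *
    -- Were the conjugate -∞ at y, every real t would bound the fixed number (p + q)/2 from above; t
    -- = (p + q)/2 - 1 is absurd.
    have ht := fun y : Y => hcoe y fun hy => by
      obtain ⟨p, q, hp, hq, -⟩ := conj_half_infConv_le hψ.ne_bot hx₀ (t := 0)
        (hy.trans_le bot_le)
      obtain ⟨p', q', hp', hq', h⟩ := conj_half_infConv_le hψ.ne_bot hx₀ (y := y)
        (t := (p + q) / 2 - 1) (hy.trans_le bot_le)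
      rw [hp, EReal.coe_eq_coe_iff] at hp'
      rw [hq, EReal.coe_eq_coe_iff] at hq'
      linarith
    rw [totalMass_outerLin ht]
    exact minMass_le_slopeMass_of_infConv hψ.ne_bot hx₀ hpos hY fun y => (ht y).le
  · rw [rotEpiSymm, if_neg h1] at *
    have hle := fun y : Y => rotConj_le_conj_conj hρ (y : E n)
    have ht := fun y : Y => hcoe y (ne_bot_of_le_ne_bot (rotConj_ne_bot hρ _) (hle y))
    rw [totalMass_outerLin ht]
    exact minMass_le_slopeMass_of_rotConj hρ hpos hY fun y => (hle y).trans (ht y).le
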